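/- Let $n\ge 1$ be an integer, $q=2^n$, and let $c\in\mathbb{F}_{q^4}$ satisfy $c^{q^2+1}=1$ and $c\neq 1$. Let $F(x)=x^{q^3+q^2+q-1}$ on $\mathbb{F}_{q^4}$, and for $i\in\{0,1,2\}$ let $\omega_{c,i}$ be the number of $b\in\mathbb{F}_{q^4}$ for which the $c$-differential equation $F(x+1)-c\,F(x)=b$ has exactly $i$ solutions $x\in\mathbb{F}_{q^4}$. Then $$\omega_{c,0}=\omega_{c,2}=\frac{q^4-q^2}{2},\qquad \omega_{c,1}=q^2.$$ The same three values are obtained when $\omega_{c,i}$ is instead the number of $b\in\mathbb{F}_{q^4}$ for which the equation $$(x+1)^{(q-1)(q^2+1)+2}+c^2x^{(q-1)(q^2+1)+2}=b^2$$ has exactly $i$ solutions $x\in\mathbb{F}_{q^4}$. -/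

import Mathlib

/-- The multiplicative `c`-derivative of `F` in direction `a`: `x ↦ F (x + a) - c * F x`. -/
def cDerivative {K : Type*} [Field K] (F : K → K) (c a x : K) : K :=
  F (x + a) - c * F x

/-- The number of solutions `x` of the `c`-differential equation `F (x + a) - c * F x = b`. -/
noncomputable def cDelta {K : Type*} [Field K] (F : K → K) (c a b : K) : ℕ :=
  {x : K | cDerivative F c a x = b}.ncard

/-- The number of `b` such that `F (x + 1) - c * F x = b` has exactly `i` solutions `x`. -/
noncomputable def cOmega {K : Type*} [Field K] (F : K → K) (c : K) (i : ℕ) : ℕ :=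
  {b : K | cDelta F c 1 b = i}.ncard

/-- The number of `b` such that the equation
`(x + 1) ^ ((q - 1) * (q ^ 2 + 1) + 2) + c ^ 2 * x ^ ((q - 1) * (q ^ 2 + 1) + 2) = b ^ 2`
has exactly `i` solutions `x` in `K`. This is a Frobenius-transformed version of the
`c`-differential equation of `x ↦ x ^ (q ^ 3 + q ^ 2 + q - 1)`. -/
noncomputable def cOmegaSq (K : Type*) [Field K] (q : ℕ) (c : K) (i : ℕ) : ℕ :=
  {b : K | {x : K | (x + 1) ^ ((q - 1) * (q ^ 2 + 1) + 2)
      + c ^ 2 * x ^ ((q - 1) * (q ^ 2 + 1) + 2) = b ^ 2}.ncard = i}.ncard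

/-!
Let `σ x = x ^ q` on `K`, let `L` and `F` be the subfields of order `q ^ 2` and `q`, that is, the
fixed fields of `σ ∘ σ` and of `σ`, and let `N x = x * σ (σ x)` be the norm from `K` to `L`.

*The equation.* Raising `x ^ (q ^ 3 + q ^ 2 + q - 1)` to the power `q ^ 2` gives
`x ^ ((q - 1) * (q ^ 2 + 1) + 2) = N x ^ (q - 1) * x ^ 2`, and `c ^ (q ^ 2) = c⁻¹`, so the first
equation is an instance of the second one, with `c` replaced by a square root of `c⁻¹`
(`exists_cOmega_eq_cOmegaSq`). Taking square roots, the second equation becomes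
`s (x + 1) * (x + 1) + c * s x * x = b`, where the twist `s x ∈ L` has `s x * σ (s x) = 1` and is
determined, for `x ≠ 0`, by `s x * N x ∈ F` (`exists_isTwist`). With `u = s (x + 1)` and `v = s x`
this is linear in `x`, so the solutions correspond to pairs `(u, v)`. Write `b = b₀ + b₁ * c` with
`b₀, b₁ ∈ L`, and put `T = c + c⁻¹` and `e = u / v + v / u ∈ F`. The conditions on the norms of `x`
and `x + 1` say that `u` and `v` are roots of `a * X ^ 2 + k₁ * X + σ a` and
`a * X ^ 2 + k₂ * X + σ a`, with coefficients depending only on `b` and `e` (`isTwistPair_iff`).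

*Solutions come in pairs.* Exchanging the roots of both quadratics keeps `e`, so it gives another
solution, and there are no more with the same `e` (`IsTwistPair.conj`,
`IsTwistPair.eq_or_eq_conj`). Moreover `e` is determined by `b` unless `b₀, b₁ ∈ F`: the resolvent
of the two quadratics is, up to the nonzero factor `(e + T) * (e + σ T)`, quadratic in `e`
(`resolvent_factor`), and its two roots are told apart by the absolute trace on `F`. An admissible
`e ≠ 0` has `1 / e` of trace one, while the sum of the inverses of the roots has the same trace as
`1 / T + 1 / σ T`, which is one as well (`artinSchreier_ne_trace`,
`IsTwistPair.ratio_unique`). Traces are not taken literally: an element has trace zero if it is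
`θ ^ 2 + θ` with `θ ∈ F`, and trace one if it is `g ^ 2 + g` with `σ g = g + 1`.

*Counting.* The two paired solutions coincide only if `u = v` and `k₁ = k₂ = 0`, which means
`b₀, b₁ ∈ F`. For these `q ^ 2` values of `b` there is exactly one solution
(`IsTwist.ncard_fibre_of_fixed`), for all others there are none or two
(`IsTwist.ncard_fibre_of_not_fixed`). As the equation defines a self-map of `K`, the numbers of
`b` with no and with two solutions are equal.
-/

/-! ### The quadratic equations for the twists -/

section Algebra

variable {K : Type*} [Field K]

/-- The value at `(b₀, b₁)` of the binary quadratic form `X ^ 2 + T * X * Y + Y ^ 2`. When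
`T = c + c⁻¹` and `c⁻¹` is the conjugate of `c` over the quadratic subfield, this is the relative
norm of `b₀ + b₁ * c`. -/
def normForm (T b₀ b₁ : K) : K := b₀ ^ 2 + T * b₀ * b₁ + b₁ ^ 2

/-- The leading coefficient `a` of the quadratics `a * X ^ 2 + k * X + σ a` for the two twists of a
solution. -/
def leadCoeff (σ : K →+* K) (T e b₀ b₁ : K) : K :=
  e + σ T + σ (normForm T b₀ b₁) * (e + T)

/-- The middle coefficient `k` of the quadratics `a * X ^ 2 + k * X + σ a` for the two twists of a
solution; `β` is the coordinate `b₁` of the right-hand side for the twist of `x + 1`, and `b₀` for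
the twist of `x`. -/
def midCoeff (σ : K →+* K) (T e β : K) : K :=
  β * T * (e + σ T) + σ β * σ T * (e + T)

/-- The twists `u` of `x + 1` and `v` of `x` belonging to a solution of the equation with
right-hand side `b₀ + b₁ * c`: both have norm one for the involution induced by `σ`, and both are
roots of self-reciprocal quadratics with the same outer coefficients, which depend on `u` and `v`
only through `u / v + v / u`. -/
structure IsTwistPair (σ : K →+* K) (T b₀ b₁ u v : K) : Prop where
  norm_u : u * σ u = 1
  norm_v : v * σ v = 1
  eq_u : leadCoeff σ T (u / v + v / u) b₀ b₁ * u ^ 2 + midCoeff σ T (u / v + v / u) b₁ * u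
    + σ (leadCoeff σ T (u / v + v / u) b₀ b₁) = 0
  eq_v : leadCoeff σ T (u / v + v / u) b₀ b₁ * v ^ 2 + midCoeff σ T (u / v + v / u) b₀ * v
    + σ (leadCoeff σ T (u / v + v / u) b₀ b₁) = 0

variable {σ : K →+* K} {c T b₀ b₁ e u v : K}

theorem inv_fixed_of_norm_one (hu : u * σ u = 1) : σ (σ u) = u := by
  have h := congrArg σ hu
  rw [map_mul, map_one] at h
  have h0 : σ u ≠ 0 := right_ne_zero_of_mul_eq_one hu
  exact mul_left_cancel₀ h0 (by rw [h, mul_comm, hu])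

theorem map_ratio_add_inv (hu : u * σ u = 1) (hv : v * σ v = 1) :
    σ (u / v + v / u) = u / v + v / u := by
  have hu0 := left_ne_zero_of_mul_eq_one hu
  have hv0 := left_ne_zero_of_mul_eq_one hv
  rw [map_add, map_div₀, map_div₀, eq_inv_of_mul_eq_one_right hu,
    eq_inv_of_mul_eq_one_right hv]
  field_simp
  ring

theorem map_leadCoeff (hT : σ (σ T) = T) (h₀ : σ (σ b₀) = b₀) (h₁ : σ (σ b₁) = b₁)
    (he : σ e = e) :
    σ (leadCoeff σ T e b₀ b₁) = e + T + normForm T b₀ b₁ * (e + σ T) := by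
  simp [leadCoeff, normForm, hT, h₀, h₁, he]

theorem map_midCoeff {β : K} (hT : σ (σ T) = T) (hβ : σ (σ β) = β) (he : σ e = e) :
    σ (midCoeff σ T e β) = midCoeff σ T e β := by
  simp [midCoeff, hT, hβ, he, add_comm]

theorem map_normForm : σ (normForm T b₀ b₁) = normForm (σ T) (σ b₀) (σ b₁) := by
  simp [normForm]

variable [CharP K 2]

/-- The twist condition on an element `X` whose multiple by `w * (e + T)` is known is a
self-reciprocal quadratic equation for `w`. -/
theorem map_eq_self_iff_quadratic {X w β : K} (hT : σ (σ T) = T) (h₀ : σ (σ b₀) = b₀)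
    (h₁ : σ (σ b₁) = b₁) (he : σ e = e) (heT : e + T ≠ 0) (hw : w * σ w = 1)
    (hX : X * (w * (e + T)) = normForm T b₀ b₁ + w * β * T + w ^ 2) :
    σ X = X ↔ leadCoeff σ T e b₀ b₁ * w ^ 2 + midCoeff σ T e β * w
      + σ (leadCoeff σ T e b₀ b₁) = 0 := by
  rw [map_leadCoeff hT h₀ h₁ he]
  have hX' := congrArg σ hX
  simp only [map_mul, map_add, map_pow, he] at hX'
  have hσeT : e + σ T ≠ 0 := by
    intro h
    apply heT
    have := congrArg σ h
    simpa [hT, he] using this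
  have hw0 := left_ne_zero_of_mul_eq_one hw
  unfold leadCoeff midCoeff
  generalize normForm T b₀ b₁ = B at *
  have key : (σ X + X) * (w * (e + T) * (e + σ T)) =
      (e + σ T + σ B * (e + T)) * w ^ 2 + (β * T * (e + σ T) + σ β * σ T * (e + T)) * w
      + (e + T + B * (e + σ T)) := by
    have h2 : σ X * (e + σ T) = σ B * w + σ β * σ T + σ w := by
      have : σ X * (e + σ T) * (w * σ w) = (σ B + σ w * σ β * σ T + σ w ^ 2) * w := by
        rw [← hX']; ring
      rw [hw, mul_one] at this
      rw [this]
      linear_combination (σ β * σ T + σ w) * hw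
    have h3 : σ X * (w * (e + T) * (e + σ T)) = (σ B * w + σ β * σ T + σ w) * (w * (e + T)) := by
      rw [← h2]; ring
    rw [add_mul, h3]
    linear_combination (e + σ T) * hX + (e + T) * hw
  rw [← key, mul_eq_zero, CharTwo.add_eq_zero]
  simp [hw0, heT, hσeT]

/-- Eliminating `u` and `v` from the two quadratics. -/
theorem resolvent_of_roots {a a' k₁ k₂ : K} (hu : u ≠ 0) (hv : v ≠ 0)
    (he : e * (u * v) = u ^ 2 + v ^ 2) (h1 : a * u ^ 2 + k₁ * u + a' = 0)
    (h2 : a * v ^ 2 + k₂ * v + a' = 0) :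
    k₁ ^ 2 + k₂ ^ 2 + k₁ * k₂ * e = a * a' * e ^ 2 := by
  grind

/-- In terms of the coordinates `b₀, b₁` the resolvent, of degree four in `e`, is divisible by
`(e + T) * (e + σ T)`. -/
theorem resolvent_factor (T T' b₀ b₀' b₁ b₁' e : K) :
    (b₁ * T * (e + T') + b₁' * T' * (e + T)) ^ 2 + (b₀ * T * (e + T') + b₀' * T' * (e + T)) ^ 2
      + (b₁ * T * (e + T') + b₁' * T' * (e + T)) * (b₀ * T * (e + T') + b₀' * T' * (e + T)) * e
      + (e + T' + normForm T' b₀' b₁' * (e + T)) * (e + T + normForm T b₀ b₁ * (e + T')) * e ^ 2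
    = (e + T) * (e + T') * ((1 + normForm T b₀ b₁) * (1 + normForm T' b₀' b₁') * e ^ 2
      + ((T + T') * (b₀ + b₀' + (b₁ + b₁')) ^ 2 + T * T' * ((b₀ + b₀') * (b₁ + b₁'))) * e
      + T * T' * (b₀ + b₀' + (b₁ + b₁')) ^ 2) := by
  unfold normForm
  grind

theorem add_ne_zero_of_not_fixed (hTσ : σ T ≠ T) (he : σ e = e) : e + T ≠ 0 := by
  intro h
  rw [CharTwo.add_eq_zero] at h
  exact hTσ (h ▸ he)

theorem add_map_ne_zero_of_not_fixed (hT : σ (σ T) = T) (hTσ : σ T ≠ T) (he : σ e = e) :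
    e + σ T ≠ 0 :=
  add_ne_zero_of_not_fixed (by rw [hT]; exact hTσ.symm) he

/-- The quadratic equation satisfied by `e = u / v + v / u`. -/
theorem IsTwistPair.quadratic (h : IsTwistPair σ T b₀ b₁ u v) (hT : σ (σ T) = T)
    (hTσ : σ T ≠ T) (h₀ : σ (σ b₀) = b₀) (h₁ : σ (σ b₁) = b₁) (he : e = u / v + v / u) :
    (1 + normForm T b₀ b₁) * (1 + normForm (σ T) (σ b₀) (σ b₁)) * e ^ 2
      + ((T + σ T) * (b₀ + σ b₀ + (b₁ + σ b₁)) ^ 2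
        + T * σ T * ((b₀ + σ b₀) * (b₁ + σ b₁))) * e
      + T * σ T * (b₀ + σ b₀ + (b₁ + σ b₁)) ^ 2 = 0 := by
  obtain ⟨hu, hv, h1, h2⟩ := h
  have hσe : σ e = e := he ▸ map_ratio_add_inv hu hv
  rw [← he] at h1 h2
  have hu0 := left_ne_zero_of_mul_eq_one hu
  have hv0 := left_ne_zero_of_mul_eq_one hv
  have heuv : e * (u * v) = u ^ 2 + v ^ 2 := by
    rw [he]
    field_simp
  have hr := resolvent_of_roots hu0 hv0 heuv h1 h2
  rw [map_leadCoeff hT h₀ h₁ hσe] at hr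
  have hf := resolvent_factor T (σ T) b₀ (σ b₀) b₁ (σ b₁) e
  unfold leadCoeff midCoeff at hr
  rw [map_normForm] at hr
  rw [hr, CharTwo.add_self_eq_zero] at hf
  have h3 := mul_ne_zero (add_ne_zero_of_not_fixed hTσ hσe)
    (add_map_ne_zero_of_not_fixed hT hTσ hσe)
  exact (mul_eq_zero.mp hf.symm).resolve_left h3

/-- When both middle coefficients and the leading coefficient vanish, `b₀ * b₁` is determined
by `e`. Here `X = e + T` and `X' = e + T'`. -/
theorem mul_eq_of_coeffs_eq_zero {T T' b₀ b₀' b₁ b₁' X X' : K} (hd : T + T' ≠ 0)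
    (hX' : X' ≠ 0) (hXX : X + X' = T + T')
    (h1 : b₁' * T' * X = b₁ * T * X') (h2 : b₀' * T' * X = b₀ * T * X')
    (ha : X' + (b₀' ^ 2 + T' * b₀' * b₁' + b₁' ^ 2) * X = 0)
    (ha' : X + (b₀ ^ 2 + T * b₀ * b₁ + b₁ ^ 2) * X' = 0) :
    (T + T') * X = T ^ 2 * X' * (b₀ * b₁) := by
  have h3 : X' * (T' ^ 2 * X + T ^ 2 * X' * (b₀ ^ 2 + T' * b₀ * b₁ + b₁ ^ 2)) = 0 := by
    linear_combination T' ^ 2 * X * ha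
      - (b₀' * T' * X + b₀ * T * X' + T' * b₁' * T' * X) * h2
      - (T' * b₀ * T * X' + b₁' * T' * X + b₁ * T * X') * h1
  have h4 := (mul_eq_zero.mp h3).resolve_left hX'
  apply mul_left_cancel₀ hd
  grind

/-- The outer coefficient of the quadratics does not vanish when the middle ones do. -/
theorem leadCoeff_ne_zero (hT : σ (σ T) = T) (hTσ : σ T ≠ T) (hT0 : T ≠ 0)
    (htr : ∀ θ, σ θ = θ → θ ^ 2 + θ ≠ 1 / T + 1 / σ T)
    (h₀ : σ (σ b₀) = b₀) (h₁ : σ (σ b₁) = b₁) (he : σ e = e)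
    (hk₁ : midCoeff σ T e b₁ = 0) (hk₂ : midCoeff σ T e b₀ = 0) :
    leadCoeff σ T e b₀ b₁ ≠ 0 := by
  intro ha
  have ha' := map_leadCoeff hT h₀ h₁ he
  rw [ha, map_zero] at ha'
  have hx := add_ne_zero_of_not_fixed hTσ he
  have hx' := add_map_ne_zero_of_not_fixed hT hTσ he
  have hT0' : σ T ≠ 0 := by simpa using hT0
  unfold leadCoeff at ha
  rw [map_normForm] at ha
  unfold midCoeff at hk₁ hk₂
  unfold normForm at ha ha'
  have hd : T + σ T ≠ 0 := by
    rw [Ne, CharTwo.add_eq_zero]; exact hTσ.symm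
  have h1 : σ b₁ * σ T * (e + T) = b₁ * T * (e + σ T) := by
    rw [← CharTwo.add_eq_zero, add_comm]; exact hk₁
  have h2 : σ b₀ * σ T * (e + T) = b₀ * T * (e + σ T) := by
    rw [← CharTwo.add_eq_zero, add_comm]; exact hk₂
  have hXX : (e + T) + (e + σ T) = T + σ T := by
    linear_combination CharTwo.add_self_eq_zero e
  have e1 := mul_eq_of_coeffs_eq_zero hd hx' hXX h1 h2 ha ha'.symm
  have hb : b₀ * b₁ ≠ 0 := by
    intro h
    rw [h, mul_zero] at e1
    exact mul_ne_zero hd hx e1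
  -- The ratio `b₁ / b₀` is fixed by `σ`, and `θ` is a rational function of it.
  have hρ : σ b₁ * b₀ = b₁ * σ b₀ := by
    apply mul_left_cancel₀ (mul_ne_zero hT0' hx)
    linear_combination b₀ * h1 - b₁ * h2
  have e2 : (b₀ + b₁) ^ 2 * (T + σ T) = T * σ T * (b₀ * b₁) := by
    apply mul_left_cancel₀ (mul_ne_zero hT0 hx')
    have hsq : (b₀ + b₁) ^ 2 * (e + σ T) + T * (b₀ * b₁) * (e + σ T) = e + T := by
      rw [← CharTwo.add_eq_zero, add_comm, ha']
      linear_combination b₀ * b₁ * (e + σ T) * CharTwo.two_eq_zero (R := K)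
    linear_combination T * (T + σ T) * hsq + T * e1
      - T ^ 2 * σ T * b₀ * b₁ * (e + σ T) * CharTwo.two_eq_zero (R := K)
  have hs : b₀ + b₁ ≠ 0 := by
    intro h
    rw [h] at e2
    exact mul_ne_zero (mul_ne_zero hT0 hT0') hb (by rw [← e2]; ring)
  have hs' : σ b₀ + σ b₁ ≠ 0 := by
    rw [← map_add]
    exact (map_ne_zero σ).mpr hs
  refine htr (b₁ / (b₀ + b₁)) ?_ ?_
  · rw [map_div₀, map_add, div_eq_div_iff hs' hs]
    linear_combination hρ
  · field_simp
    linear_combination -e2 + (T * σ T * b₁ ^ 2) * CharTwo.two_eq_zero (R := K)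

end Algebra

/-! ### Uniqueness of the ratio and the pairing of twists -/

section Trace

variable {K : Type*} [Field K] {σ : K →+* K} {c T b₀ b₁ u v : K}

theorem quadratic_conj_root {a k w : K} (ha : a ≠ 0) (hw : w ≠ 0)
    (h : a * w ^ 2 + k * w + σ a = 0) :
    a * (σ a / a / w) ^ 2 + k * (σ a / a / w) + σ a = 0 := by
  field_simp
  linear_combination σ a * h

theorem ratio_eq_or {r s : K} (hr : r ≠ 0) (hs : s ≠ 0) (h : r + r⁻¹ = s + s⁻¹) :
    s = r ∨ s = r⁻¹ := by
  have h2 : (s - r) * (s * r - 1) = 0 := by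
    field_simp at h
    linear_combination -h
  rcases mul_eq_zero.mp h2 with h3 | h3
  · exact Or.inl (sub_eq_zero.mp h3)
  · exact Or.inr (eq_inv_of_mul_eq_one_left (sub_eq_zero.mp h3))

theorem eq_or_eq_of_quadratic {a k a' w z : K} (ha : a ≠ 0) (hw : w ≠ 0)
    (h : a * w ^ 2 + k * w + a' = 0) (h' : a * z ^ 2 + k * z + a' = 0) :
    z = w ∨ z = a' / a / w := by
  by_cases hzw : z = w
  · exact Or.inl hzw
  right
  have hd : z - w ≠ 0 := sub_ne_zero.mpr hzw
  have hk : a * (z + w) + k = 0 := by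
    apply mul_left_cancel₀ hd
    linear_combination h' - h
  field_simp
  linear_combination w * hk - h

variable [CharP K 2]

/-- Over the field fixed by `σ`, the relative trace of `1 / T` is not of the form `θ ^ 2 + θ`:
it equals `m ^ 2 + m` for `m = g + σ g` with `g = 1 / (c + 1)`, and `m` is not fixed by `σ`. -/
theorem artinSchreier_ne_trace (hc : c * σ (σ c) = 1) (hc1 : c ≠ 1) (hT : T = c + σ (σ c))
    {θ : K} (hθ : σ θ = θ) : θ ^ 2 + θ ≠ 1 / T + 1 / σ T := by
  intro h
  have hc2 : c + 1 ≠ 0 := by rwa [Ne, CharTwo.add_eq_zero]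
  have hT1 : c * T = (c + 1) ^ 2 := by
    rw [hT]
    linear_combination hc - c * CharTwo.two_eq_zero (R := K)
  have hT0 : T ≠ 0 := by
    rintro rfl
    rw [mul_zero] at hT1
    exact pow_ne_zero 2 hc2 hT1.symm
  obtain ⟨g, hg⟩ : ∃ g, g = 1 / (c + 1) := ⟨_, rfl⟩
  have hgT : g ^ 2 + g = 1 / T := by
    rw [hg, eq_div_iff hT0]
    field_simp
    linear_combination hT1 + T * CharTwo.two_eq_zero (R := K)
  have hgT' : σ g ^ 2 + σ g = 1 / σ T := by
    rw [← map_pow, ← map_add, hgT, map_div₀, map_one]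
  have hz : (θ + g + σ g) * (θ + g + σ g + 1) = 0 := by
    rw [← hgT, ← hgT'] at h
    grind
  have hfix : σ (g + σ g) = g + σ g := by
    rcases mul_eq_zero.mp hz with h0 | h0
    · have : g + σ g = θ := by grind
      rw [this, hθ]
    · have : g + σ g = θ + 1 := by grind
      rw [this, map_add, hθ, map_one]
  have h2 : σ (σ g) = g := by
    rw [map_add] at hfix
    grind
  have h3 : σ (σ c) = c := by
    rw [hg] at h2
    simpa using h2
  rw [h3] at hc
  apply hc1
  have : (c + 1) ^ 2 = 0 := by grind
  exact absurd (pow_eq_zero_iff two_ne_zero |>.mp this) hc2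

/-- For `e = u / v + v / u ≠ 0` with `u, v` of norm one, `1 / e` has absolute trace one over the
field fixed by `σ`: a solution `g` of `g ^ 2 + g = 1 / e` is moved by `σ`. -/
theorem exists_artinSchreier_ratio (hu : u * σ u = 1) (hv : v * σ v = 1)
    (he : u / v + v / u ≠ 0) :
    ∃ g, g ^ 2 + g = 1 / (u / v + v / u) ∧ σ g = g + 1 := by
  have hu0 := left_ne_zero_of_mul_eq_one hu
  have hv0 := left_ne_zero_of_mul_eq_one hv
  have huv : u + v ≠ 0 := by
    intro h
    rw [CharTwo.add_eq_zero] at h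
    apply he
    rw [h, CharTwo.add_self_eq_zero]
  have he' : u / v + v / u = (u + v) ^ 2 / (u * v) := by
    field_simp
    linear_combination (-u * v) * CharTwo.two_eq_zero (R := K)
  refine ⟨v / (u + v), ?_, ?_⟩
  · rw [he']
    field_simp
    linear_combination v * CharTwo.two_eq_zero (R := K)
  · rw [map_div₀, map_add, eq_inv_of_mul_eq_one_right hu, eq_inv_of_mul_eq_one_right hv]
    have : u⁻¹ + v⁻¹ ≠ 0 := by
      have h : u⁻¹ + v⁻¹ = (u + v) / (u * v) := by
        field_simp
        ring
      rw [h]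
      exact div_ne_zero huv (mul_ne_zero hu0 hv0)
    have h2 : v + u ≠ 0 := by rwa [add_comm]
    field_simp
    linear_combination -(u * v + v ^ 2) * CharTwo.two_eq_zero (R := K)

/-- A self-reciprocal quadratic `a * X ^ 2 + k * X + σ a` with a root of norm one and `k ≠ 0` has
an invariant `a * σ a / k ^ 2` of absolute trace one over the field fixed by `σ`. -/
theorem exists_artinSchreier_root {a k w : K} (hw : w * σ w = 1) (hk : σ k = k) (hk0 : k ≠ 0)
    (h : a * w ^ 2 + k * w + σ a = 0) :
    ∃ g, g ^ 2 + g = a * σ a / k ^ 2 ∧ σ g = g + 1 := by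
  have hw0 := left_ne_zero_of_mul_eq_one hw
  refine ⟨a * w / k, ?_, ?_⟩
  · field_simp
    linear_combination a * h - a * σ a * CharTwo.two_eq_zero (R := K)
  · rw [map_div₀, map_mul, hk, eq_inv_of_mul_eq_one_right hw]
    field_simp
    linear_combination h - (a * w ^ 2 + w * k) * CharTwo.two_eq_zero (R := K)

/-- Two elements of trace one cannot add up to an element of trace one. -/
theorem false_of_artinSchreier {g₁ g₂ θ τ : K}
    (htr : ∀ θ, σ θ = θ → θ ^ 2 + θ ≠ τ)
    (h₁ : σ g₁ = g₁ + 1) (h₂ : σ g₂ = g₂ + 1) (hθ : σ θ = θ)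
    (h : (g₁ ^ 2 + g₁) + (g₂ ^ 2 + g₂) = τ + (θ ^ 2 + θ)) : False := by
  refine htr (g₁ + g₂ + θ) ?_ ?_
  · rw [map_add, map_add, h₁, h₂, hθ]
    linear_combination CharTwo.two_eq_zero (R := K)
  · grind

/-- The polynomial identity behind `IsTwistPair.false_of_zero_of_ne_zero`. -/
theorem trace_identity_aux (T T' b₀ b₀' f : K) :
    (T' + normForm T' b₀' (b₀' + f) * T) * (T + normForm T b₀ (b₀ + f) * T')
      + T * T' * ((1 + normForm T b₀ (b₀ + f)) * (1 + normForm T' b₀' (b₀' + f)))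
      = (b₀ + b₀') ^ 2 * (T * T' * (T + T')) + f ^ 2 * (T + T') ^ 2
        + f * (b₀ + b₀') * (T * T' * (T + T')) := by
  unfold normForm
  grind

variable {u₂ v₂ : K}

/-- The two values `0` and `e ≠ 0` cannot both occur: the traces of `1 / e` and of the invariant
of the quadratic at `0` differ by the trace of `1 / T`. -/
theorem IsTwistPair.false_of_zero_of_ne_zero
    (h : IsTwistPair σ T b₀ b₁ u v) (h' : IsTwistPair σ T b₀ b₁ u₂ v₂)
    (hT : σ (σ T) = T) (hTσ : σ T ≠ T) (hT0 : T ≠ 0)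
    (htr : ∀ θ, σ θ = θ → θ ^ 2 + θ ≠ 1 / T + 1 / σ T)
    (h₀ : σ (σ b₀) = b₀) (h₁ : σ (σ b₁) = b₁)
    (hδ : b₀ + σ b₀ + (b₁ + σ b₁) = 0) (hβ : b₀ + σ b₀ ≠ 0)
    (he : u / v + v / u = 0) (he' : u₂ / v₂ + v₂ / u₂ ≠ 0) : False := by
  have hq := h'.quadratic hT hTσ h₀ h₁ rfl
  obtain ⟨g₂, hg₂, hs₂⟩ := exists_artinSchreier_ratio h'.norm_u h'.norm_v he'
  generalize u₂ / v₂ + v₂ / u₂ = e at *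
  have hT0' : σ T ≠ 0 := (map_ne_zero σ).mpr hT0
  have hβ1 : b₁ + σ b₁ = b₀ + σ b₀ := (CharTwo.add_eq_zero.mp hδ).symm
  have hk : midCoeff σ T 0 b₁ = T * σ T * (b₀ + σ b₀) := by
    rw [← hβ1]
    unfold midCoeff
    ring
  obtain ⟨f, hf⟩ : ∃ f, b₁ = b₀ + f := ⟨b₁ - b₀, by ring⟩
  have hfσ : σ f = f := by
    rw [hf, map_add] at hβ1
    grind
  have h1 := h.eq_u
  rw [he] at h1
  obtain ⟨g₁, hg₁, hs₁⟩ := exists_artinSchreier_root h.norm_u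
    (map_midCoeff hT h₁ (map_zero σ)) (by rw [hk]; exact mul_ne_zero (mul_ne_zero hT0 hT0') hβ) h1
  rw [map_leadCoeff hT h₀ h₁ (map_zero σ), hk] at hg₁
  unfold leadCoeff at hg₁
  rw [map_normForm] at hg₁
  have hσ₁ : σ b₁ = σ b₀ + f := by rw [hf, map_add, hfσ]
  rw [hδ, hβ1, hσ₁, hf] at hq
  rw [hσ₁, hf] at hg₁
  have hq' : (1 + normForm T b₀ (b₀ + f)) * (1 + normForm (σ T) (σ b₀) (σ b₀ + f)) * e
      = T * σ T * (b₀ + σ b₀) ^ 2 := by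
    rw [← CharTwo.add_eq_zero]
    apply mul_left_cancel₀ he'
    linear_combination hq
  have hinv : 1 / e = (1 + normForm T b₀ (b₀ + f)) * (1 + normForm (σ T) (σ b₀) (σ b₀ + f))
      / (T * σ T * (b₀ + σ b₀) ^ 2) := by
    rw [div_eq_div_iff he' (mul_ne_zero (mul_ne_zero hT0 hT0') (pow_ne_zero 2 hβ)), one_mul, hq']
  have hid := trace_identity_aux T (σ T) b₀ (σ b₀) f
  refine false_of_artinSchreier (θ := f / (b₀ + σ b₀) * (1 / T + 1 / σ T)) htr hs₁ hs₂ ?_ ?_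
  · simp only [map_mul, map_add, map_div₀, map_one, hfσ, hT, h₀]
    rw [add_comm (σ b₀), add_comm (1 / σ T)]
  · rw [hg₁, hg₂, hinv]
    field_simp
    linear_combination hid

/-- When the coordinates have distinct traces, two distinct values of `e` would be the two roots
of `IsTwistPair.quadratic`, and the sum of their inverses has the trace of `1 / T`. -/
theorem IsTwistPair.ratio_unique_of_ne
    (h : IsTwistPair σ T b₀ b₁ u v) (h' : IsTwistPair σ T b₀ b₁ u₂ v₂)
    (hT : σ (σ T) = T) (hTσ : σ T ≠ T) (hT0 : T ≠ 0)
    (htr : ∀ θ, σ θ = θ → θ ^ 2 + θ ≠ 1 / T + 1 / σ T)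
    (h₀ : σ (σ b₀) = b₀) (h₁ : σ (σ b₁) = b₁)
    (hδ : b₀ + σ b₀ + (b₁ + σ b₁) ≠ 0) :
    u / v + v / u = u₂ / v₂ + v₂ / u₂ := by
  by_contra hne
  have hq := h.quadratic hT hTσ h₀ h₁ rfl
  have hq' := h'.quadratic hT hTσ h₀ h₁ rfl
  have hT0' : σ T ≠ 0 := (map_ne_zero σ).mpr hT0
  have hC := mul_ne_zero (mul_ne_zero hT0 hT0') (pow_ne_zero 2 hδ)
  have he : u / v + v / u ≠ 0 := by
    intro h
    rw [h] at hq
    apply hC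
    linear_combination hq
  have he' : u₂ / v₂ + v₂ / u₂ ≠ 0 := by
    intro h
    rw [h] at hq'
    apply hC
    linear_combination hq'
  obtain ⟨g₁, hg₁, hs₁⟩ := exists_artinSchreier_ratio h.norm_u h.norm_v he
  obtain ⟨g₂, hg₂, hs₂⟩ := exists_artinSchreier_ratio h'.norm_u h'.norm_v he'
  generalize u₂ / v₂ + v₂ / u₂ = e' at *
  generalize u / v + v / u = e at *
  generalize (1 + normForm T b₀ b₁) * (1 + normForm (σ T) (σ b₀) (σ b₁)) = P at *
  have hd : e - e' ≠ 0 := sub_ne_zero.mpr hne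
  have hsum : P * (e + e') = (T + σ T) * (b₀ + σ b₀ + (b₁ + σ b₁)) ^ 2
      + T * σ T * ((b₀ + σ b₀) * (b₁ + σ b₁)) := by
    rw [← CharTwo.add_eq_zero]
    apply mul_left_cancel₀ hd
    linear_combination hq - hq'
  have hprod : P * (e * e') = T * σ T * (b₀ + σ b₀ + (b₁ + σ b₁)) ^ 2 := by
    rw [← sub_eq_zero]
    apply mul_left_cancel₀ hd
    linear_combination e' * hq - e * hq'
  obtain ⟨β₀, hβ₀⟩ : ∃ β, β = b₀ + σ b₀ := ⟨_, rfl⟩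
  obtain ⟨β₁, hβ₁⟩ : ∃ β, β = b₁ + σ b₁ := ⟨_, rfl⟩
  have hβ₀σ : σ β₀ = β₀ := by rw [hβ₀, map_add, h₀, add_comm]
  have hβ₁σ : σ β₁ = β₁ := by rw [hβ₁, map_add, h₁, add_comm]
  rw [← hβ₀, ← hβ₁] at hδ hC hsum hprod
  have hP : P ≠ 0 := by
    rintro rfl
    exact hC (by rw [← hprod, zero_mul])
  refine false_of_artinSchreier (θ := β₀ / (β₀ + β₁)) htr hs₁ hs₂ ?_ ?_
  · rw [map_div₀, map_add, hβ₀σ, hβ₁σ]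
  · have e1 : 1 / e + 1 / e' = (P * (e + e')) / (P * (e * e')) := by
      field_simp
      ring
    rw [hg₁, hg₂, e1, hsum, hprod]
    field_simp
    linear_combination (-T * σ T * β₀ ^ 2) * CharTwo.two_eq_zero (R := K)

/-- The value `u / v + v / u` is determined by the right-hand side `b₀ + b₁ * c`, unless both
coordinates are fixed by `σ`. -/
theorem IsTwistPair.ratio_unique
    (h : IsTwistPair σ T b₀ b₁ u v) (h' : IsTwistPair σ T b₀ b₁ u₂ v₂)
    (hT : σ (σ T) = T) (hTσ : σ T ≠ T) (hT0 : T ≠ 0)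
    (htr : ∀ θ, σ θ = θ → θ ^ 2 + θ ≠ 1 / T + 1 / σ T)
    (h₀ : σ (σ b₀) = b₀) (h₁ : σ (σ b₁) = b₁)
    (hb : ¬ (σ b₀ = b₀ ∧ σ b₁ = b₁)) :
    u / v + v / u = u₂ / v₂ + v₂ / u₂ := by
  by_cases hδ : b₀ + σ b₀ + (b₁ + σ b₁) = 0
  swap
  · exact h.ratio_unique_of_ne h' hT hTσ hT0 htr h₀ h₁ hδ
  have hβ : b₀ + σ b₀ ≠ 0 := by
    intro h0
    rw [h0, zero_add] at hδ
    exact hb ⟨(CharTwo.add_eq_zero.mp h0).symm, (CharTwo.add_eq_zero.mp hδ).symm⟩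
  have hq := h.quadratic hT hTσ h₀ h₁ rfl
  have hq' := h'.quadratic hT hTσ h₀ h₁ rfl
  have hT0' : σ T ≠ 0 := (map_ne_zero σ).mpr hT0
  by_cases he : u / v + v / u = 0
  · by_cases he' : u₂ / v₂ + v₂ / u₂ = 0
    · rw [he, he']
    · exact (h.false_of_zero_of_ne_zero h' hT hTσ hT0 htr h₀ h₁ hδ hβ he he').elim
  · by_cases he' : u₂ / v₂ + v₂ / u₂ = 0
    · exact (h'.false_of_zero_of_ne_zero h hT hTσ hT0 htr h₀ h₁ hδ hβ he' he).elim
    · rw [hδ] at hq hq'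
      generalize u₂ / v₂ + v₂ / u₂ = e' at *
      generalize u / v + v / u = e at *
      have hC : T * σ T * ((b₀ + σ b₀) * (b₁ + σ b₁)) ≠ 0 := by
        rw [← CharTwo.add_eq_zero.mp hδ]
        exact mul_ne_zero (mul_ne_zero hT0 hT0') (mul_ne_zero hβ hβ)
      generalize (1 + normForm T b₀ b₁) * (1 + normForm (σ T) (σ b₀) (σ b₁)) = P at *
      have h1 : e * (P * e + T * σ T * ((b₀ + σ b₀) * (b₁ + σ b₁))) = 0 := by
        linear_combination hq
      have h2 : e' * (P * e' + T * σ T * ((b₀ + σ b₀) * (b₁ + σ b₁))) = 0 := by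
        linear_combination hq'
      replace h1 := (mul_eq_zero.mp h1).resolve_left he
      replace h2 := (mul_eq_zero.mp h2).resolve_left he'
      have hP : P ≠ 0 := by
        rintro rfl
        exact hC (by linear_combination h1)
      apply mul_left_cancel₀ hP
      linear_combination h1 - h2

/-- The quadratics of a twist pair are nondegenerate. -/
theorem IsTwistPair.leadCoeff_ne_zero (h : IsTwistPair σ T b₀ b₁ u v)
    (hT : σ (σ T) = T) (hTσ : σ T ≠ T) (hT0 : T ≠ 0)
    (htr : ∀ θ, σ θ = θ → θ ^ 2 + θ ≠ 1 / T + 1 / σ T)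
    (h₀ : σ (σ b₀) = b₀) (h₁ : σ (σ b₁) = b₁) :
    leadCoeff σ T (u / v + v / u) b₀ b₁ ≠ 0 := by
  intro ha
  have h1 := h.eq_u
  have h2 := h.eq_v
  rw [ha] at h1 h2
  have hk₁ : midCoeff σ T (u / v + v / u) b₁ = 0 := by
    simpa [left_ne_zero_of_mul_eq_one h.norm_u] using h1
  have hk₂ : midCoeff σ T (u / v + v / u) b₀ = 0 := by
    simpa [left_ne_zero_of_mul_eq_one h.norm_v] using h2
  exact _root_.leadCoeff_ne_zero hT hTσ hT0 htr h₀ h₁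
    (map_ratio_add_inv h.norm_u h.norm_v) hk₁ hk₂ ha

/-- Replacing both twists by the other roots of their quadratics preserves the conditions. -/
theorem IsTwistPair.conj {w : K} (h : IsTwistPair σ T b₀ b₁ u v)
    (hT : σ (σ T) = T) (hTσ : σ T ≠ T) (hT0 : T ≠ 0)
    (htr : ∀ θ, σ θ = θ → θ ^ 2 + θ ≠ 1 / T + 1 / σ T)
    (h₀ : σ (σ b₀) = b₀) (h₁ : σ (σ b₁) = b₁)
    (hw : w = σ (leadCoeff σ T (u / v + v / u) b₀ b₁) / leadCoeff σ T (u / v + v / u) b₀ b₁) :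
    IsTwistPair σ T b₀ b₁ (w / u) (w / v) := by
  have ha := h.leadCoeff_ne_zero hT hTσ hT0 htr h₀ h₁
  have hu0 := left_ne_zero_of_mul_eq_one h.norm_u
  have hv0 := left_ne_zero_of_mul_eq_one h.norm_v
  have ha' := (map_ne_zero σ).mpr ha
  have hσ : σ (σ (leadCoeff σ T (u / v + v / u) b₀ b₁)) = leadCoeff σ T (u / v + v / u) b₀ b₁ := by
    simp [leadCoeff, normForm, hT, h₀, h₁, inv_fixed_of_norm_one h.norm_u,
      inv_fixed_of_norm_one h.norm_v]
  have hw0 : w ≠ 0 := by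
    rw [hw]
    exact div_ne_zero ha' ha
  have hww : w * σ w = 1 := by
    rw [hw, map_div₀, hσ, div_mul_div_comm, mul_comm, div_self (mul_ne_zero ha ha')]
  have hr : (w / u) / (w / v) + (w / v) / (w / u) = u / v + v / u := by
    field_simp
    ring
  refine ⟨?_, ?_, ?_, ?_⟩
  · rw [map_div₀, div_mul_div_comm, hww, h.norm_u, div_one]
  · rw [map_div₀, div_mul_div_comm, hww, h.norm_v, div_one]
  · rw [hr, hw]
    exact quadratic_conj_root ha hu0 h.eq_u
  · rw [hr, hw]
    exact quadratic_conj_root ha hv0 h.eq_v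

/-- A right-hand side with a given value of `u / v + v / u` has at most two twist pairs. -/
theorem IsTwistPair.eq_or_eq_conj {w : K} (h : IsTwistPair σ T b₀ b₁ u v)
    (h' : IsTwistPair σ T b₀ b₁ u₂ v₂)
    (hT : σ (σ T) = T) (hTσ : σ T ≠ T) (hT0 : T ≠ 0)
    (htr : ∀ θ, σ θ = θ → θ ^ 2 + θ ≠ 1 / T + 1 / σ T)
    (h₀ : σ (σ b₀) = b₀) (h₁ : σ (σ b₁) = b₁)
    (he : u / v + v / u = u₂ / v₂ + v₂ / u₂)
    (hw : w = σ (leadCoeff σ T (u / v + v / u) b₀ b₁) / leadCoeff σ T (u / v + v / u) b₀ b₁) :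
    (u₂ = u ∧ v₂ = v) ∨ (u₂ = w / u ∧ v₂ = w / v) := by
  have ha := h.leadCoeff_ne_zero hT hTσ hT0 htr h₀ h₁
  have hu0 := left_ne_zero_of_mul_eq_one h.norm_u
  have hv0 := left_ne_zero_of_mul_eq_one h.norm_v
  have hu0' := left_ne_zero_of_mul_eq_one h'.norm_u
  have hv0' := left_ne_zero_of_mul_eq_one h'.norm_v
  have h1 := h'.eq_u
  have h2 := h'.eq_v
  rw [← he] at h1 h2
  have hu := eq_or_eq_of_quadratic ha hu0 h.eq_u h1
  have hv := eq_or_eq_of_quadratic ha hv0 h.eq_v h2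
  rw [← hw] at hu hv
  have hr : u₂ / v₂ = u / v ∨ u₂ / v₂ = (u / v)⁻¹ := by
    apply ratio_eq_or (div_ne_zero hu0 hv0) (div_ne_zero hu0' hv0')
    rw [inv_div, inv_div, he]
  rcases hu with hu | hu <;> rcases hv with hv | hv
  · exact Or.inl ⟨hu, hv⟩
  · rcases hr with hr | hr
    · left
      refine ⟨hu, ?_⟩
      rw [hu] at hr
      field_simp at hr
      exact hr.symm
    · right
      refine ⟨?_, hv⟩
      rw [hu, hv] at hr
      rw [hu]
      field_simp at hr ⊢
      exact eq_of_div_eq_one hr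
  · rcases hr with hr | hr
    · left
      refine ⟨?_, hv⟩
      rw [hv] at hr
      field_simp at hr
      exact hr
    · right
      refine ⟨hu, ?_⟩
      rw [hu, hv] at hr
      rw [hv]
      field_simp at hr ⊢
      exact hr.symm
  · exact Or.inr ⟨hu, hv⟩

end Trace

/-! ### From solutions to twist pairs and back -/

section Solutions

variable {K : Type*} [Field K]

/-- A twist for `σ`: a function `s` into the elements of norm one such that `s x` times the
relative norm `x * σ (σ x)` is fixed by `σ`; for `x ≠ 0` this determines `s x`. -/
structure IsTwist (σ : K →+* K) (s : K → K) : Prop where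
  norm_one : ∀ x, s x * σ (s x) = 1
  map_mul_norm : ∀ x, σ (s x * (x * σ (σ x))) = s x * (x * σ (σ x))
  eq_of_map : ∀ x v, x ≠ 0 → v * σ v = 1 → σ (v * (x * σ (σ x))) = v * (x * σ (σ x)) → s x = v

/-- The map `x ↦ P (x + 1) + c * P x` for the twisted identity `P x = s x * x`. -/
def twistedDerivative (s : K → K) (c x : K) : K := s (x + 1) * (x + 1) + c * (s x * x)

theorem IsTwist.apply_one {σ : K →+* K} {s : K → K} (hs : IsTwist σ s) : s 1 = 1 :=
  hs.eq_of_map 1 1 one_ne_zero (by simp) (by simp)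

variable {σ : K →+* K} {s : K → K} {c b₀ b₁ u v x : K}

/-- The relative norm of the denominator `u + c * v`. -/
theorem norm_add_mul (hc : c * σ (σ c) = 1) (hu : u ≠ 0) (hv : v ≠ 0) :
    (u + c * v) * (u + σ (σ c) * v) = u * v * (u / v + v / u + (c + σ (σ c))) := by
  field_simp
  linear_combination v ^ 2 * hc

theorem IsTwist.twistedDerivative_zero (hs : IsTwist σ s) : twistedDerivative s c 0 = 1 := by
  simp [twistedDerivative, hs.apply_one]

variable [CharP K 2]

theorem map_trace_ne (hc : c * σ (σ c) = 1) (hc1 : c ≠ 1) :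
    σ (c + σ (σ c)) ≠ c + σ (σ c) := by
  intro h
  have hsq : c * c ≠ 1 := by
    intro h1
    have h2 : (c - 1) * (c - 1) = 0 := by
      linear_combination h1 + (1 - c) * CharTwo.two_eq_zero (R := K)
    exact hc1 (sub_eq_zero.mp (mul_self_eq_zero.mp h2))
  have hc3 := congrArg σ hc
  rw [map_mul, map_one] at hc3
  rw [map_add] at h
  have h2 : (σ c - c) * (c * σ c - 1) = 0 := by
    linear_combination c * σ c * h + σ c * hc - c * hc3
  rcases mul_eq_zero.mp h2 with h3 | h3
  · rw [sub_eq_zero.mp h3, sub_eq_zero.mp h3] at hc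
    exact hsq hc
  · have h4 := sub_eq_zero.mp h3
    have h5 : σ (σ c) = c := by
      rw [eq_inv_of_mul_eq_one_right h4, map_inv₀, eq_inv_of_mul_eq_one_right h4, inv_inv]
    rw [h5] at hc
    exact hsq hc

theorem trace_ne_zero (hc : c * σ (σ c) = 1) (hc1 : c ≠ 1) : c + σ (σ c) ≠ 0 := by
  intro h
  apply map_trace_ne hc hc1
  rw [h, map_zero]

theorem add_mul_ne_zero (hc : c * σ (σ c) = 1) (hc1 : c ≠ 1)
    (hu : u * σ u = 1) (hv : v * σ v = 1) : u + c * v ≠ 0 := by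
  have hu0 := left_ne_zero_of_mul_eq_one hu
  have hv0 := left_ne_zero_of_mul_eq_one hv
  intro h
  have h1 := norm_add_mul hc hu0 hv0
  rw [h, zero_mul] at h1
  exact mul_ne_zero (mul_ne_zero hu0 hv0)
    (add_ne_zero_of_not_fixed (map_trace_ne hc hc1) (map_ratio_add_inv hu hv)) h1.symm

/-- The conditions that `u` and `v` are the twists of `x + 1` and `x`, for `x` the solution of the
equation linearized by `u` and `v`, amount to `IsTwistPair`. -/
theorem isTwistPair_iff (hc : c * σ (σ c) = 1) (hc1 : c ≠ 1)
    (hcc : σ (σ (σ (σ c))) = c) (h₀ : σ (σ b₀) = b₀) (h₁ : σ (σ b₁) = b₁)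
    (hu : u * σ u = 1) (hv : v * σ v = 1) (hx : x * (u + c * v) = b₀ + b₁ * c + u) :
    IsTwistPair σ (c + σ (σ c)) b₀ b₁ u v ↔
      σ (v * (x * σ (σ x))) = v * (x * σ (σ x)) ∧
      σ (u * ((x + 1) * σ (σ (x + 1)))) = u * ((x + 1) * σ (σ (x + 1))) := by
  have hu0 := left_ne_zero_of_mul_eq_one hu
  have hv0 := left_ne_zero_of_mul_eq_one hv
  have hT : σ (σ (c + σ (σ c))) = c + σ (σ c) := by simp [hcc, add_comm]
  have he := map_ratio_add_inv hu hv
  have heT := add_ne_zero_of_not_fixed (map_trace_ne hc hc1) he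
  have hD := norm_add_mul hc hu0 hv0
  have hx2 : σ (σ x) * (u + σ (σ c) * v) = b₀ + b₁ * σ (σ c) + u := by
    have := congrArg (fun z => σ (σ z)) hx
    simpa [h₀, h₁, inv_fixed_of_norm_one hu, inv_fixed_of_norm_one hv] using this
  have hy : (x + 1) * (u + c * v) = b₀ + b₁ * c + c * v := by
    linear_combination hx + u * CharTwo.two_eq_zero (R := K)
  have hy2 : (σ (σ x) + 1) * (u + σ (σ c) * v) = b₀ + b₁ * σ (σ c) + σ (σ c) * v := by
    linear_combination hx2 + u * CharTwo.two_eq_zero (R := K)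
  have h1 := map_eq_self_iff_quadratic (X := v * (x * σ (σ x))) (β := b₁) hT h₀ h₁ he heT hu (by
    unfold normForm
    linear_combination (-x * σ (σ x)) * hD + σ (σ x) * (u + σ (σ c) * v) * hx
      + (b₀ + b₁ * c + u) * hx2 + b₁ ^ 2 * hc + u * b₀ * CharTwo.two_eq_zero (R := K))
  have h2 := map_eq_self_iff_quadratic (X := u * ((x + 1) * σ (σ (x + 1)))) (β := b₀)
    hT h₀ h₁ he heT hv (by
    unfold normForm
    simp only [map_add, map_one]
    linear_combination (-(x + 1) * (σ (σ x) + 1)) * hD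
      + (σ (σ x) + 1) * (u + σ (σ c) * v) * hy
      + (b₀ + b₁ * c + c * v) * hy2 + (b₁ ^ 2 + v ^ 2) * hc
      + v * b₁ * c * σ (σ c) * CharTwo.two_eq_zero (R := K))
  rw [h1, h2]
  exact ⟨fun h => ⟨h.eq_u, h.eq_v⟩, fun h => ⟨hu, hv, h.1, h.2⟩⟩

/-- Every element has coordinates `b₀, b₁` with respect to `1, c` over the subfield fixed by
`σ ∘ σ`. -/
theorem exists_coordinates (hσ : ∀ x, σ (σ (σ (σ x))) = x) (hc : c * σ (σ c) = 1) (hc1 : c ≠ 1)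
    (b : K) : ∃ b₀ b₁, σ (σ b₀) = b₀ ∧ σ (σ b₁) = b₁ ∧ b = b₀ + b₁ * c := by
  have hT := trace_ne_zero hc hc1
  have h1 : σ (σ ((b + σ (σ b)) / (c + σ (σ c)))) = (b + σ (σ b)) / (c + σ (σ c)) := by
    simp only [map_div₀, map_add, hσ]
    rw [add_comm b, add_comm c]
  refine ⟨b - (b + σ (σ b)) / (c + σ (σ c)) * c, (b + σ (σ b)) / (c + σ (σ c)), ?_, h1, by ring⟩
  rw [map_sub, map_sub, map_mul, map_mul, h1]
  field_simp
  linear_combination (σ (σ b) * c - σ (σ c) * b) * CharTwo.two_eq_zero (R := K)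

theorem coordinates_unique {d₀ d₁ : K} (hc : c * σ (σ c) = 1) (hc1 : c ≠ 1)
    (h₀ : σ (σ b₀) = b₀) (h₁ : σ (σ b₁) = b₁) (hd₀ : σ (σ d₀) = d₀) (hd₁ : σ (σ d₁) = d₁)
    (h : b₀ + b₁ * c = d₀ + d₁ * c) : b₀ = d₀ ∧ b₁ = d₁ := by
  have h2 : b₀ + b₁ * σ (σ c) = d₀ + d₁ * σ (σ c) := by
    have := congrArg (fun z => σ (σ z)) h
    simpa [h₀, h₁, hd₀, hd₁] using this
  have h3 : (c + σ (σ c)) * (b₁ - d₁) = 0 := by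
    linear_combination h - h2 + σ (σ c) * (b₁ - d₁) * CharTwo.two_eq_zero (R := K)
  have h4 := sub_eq_zero.mp ((mul_eq_zero.mp h3).resolve_left (trace_ne_zero hc hc1))
  refine ⟨?_, h4⟩
  rw [h4] at h
  exact add_right_cancel h

theorem IsTwist.isTwistPair (hs : IsTwist σ s) (hc : c * σ (σ c) = 1) (hc1 : c ≠ 1)
    (hcc : σ (σ (σ (σ c))) = c) (h₀ : σ (σ b₀) = b₀) (h₁ : σ (σ b₁) = b₁)
    (hx : twistedDerivative s c x = b₀ + b₁ * c) :
    IsTwistPair σ (c + σ (σ c)) b₀ b₁ (s (x + 1)) (s x) ∧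
      x * (s (x + 1) + c * s x) = b₀ + b₁ * c + s (x + 1) := by
  have hx' : x * (s (x + 1) + c * s x) = b₀ + b₁ * c + s (x + 1) := by
    unfold twistedDerivative at hx
    linear_combination hx - s (x + 1) * CharTwo.two_eq_zero (R := K)
  exact ⟨(isTwistPair_iff hc hc1 hcc h₀ h₁ (hs.norm_one _) (hs.norm_one _) hx').mpr
    ⟨hs.map_mul_norm _, hs.map_mul_norm _⟩, hx'⟩

theorem IsTwist.of_isTwistPair (hs : IsTwist σ s) (hc : c * σ (σ c) = 1) (hc1 : c ≠ 1)
    (hcc : σ (σ (σ (σ c))) = c) (h₀ : σ (σ b₀) = b₀) (h₁ : σ (σ b₁) = b₁)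
    (h : IsTwistPair σ (c + σ (σ c)) b₀ b₁ u v)
    (hx : x * (u + c * v) = b₀ + b₁ * c + u) (hx0 : x ≠ 0) (hx1 : x ≠ 1) :
    s (x + 1) = u ∧ s x = v ∧ twistedDerivative s c x = b₀ + b₁ * c := by
  obtain ⟨hv, hu⟩ := (isTwistPair_iff hc hc1 hcc h₀ h₁ h.norm_u h.norm_v hx).mp h
  have hx1' : x + 1 ≠ 0 := by rwa [Ne, CharTwo.add_eq_zero]
  have e1 := hs.eq_of_map _ _ hx1' h.norm_u hu
  have e2 := hs.eq_of_map _ _ hx0 h.norm_v hv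
  refine ⟨e1, e2, ?_⟩
  unfold twistedDerivative
  rw [e1, e2]
  linear_combination hx + u * CharTwo.two_eq_zero (R := K)

theorem IsTwist.twistedDerivative_one (hs : IsTwist σ s) : twistedDerivative s c 1 = c := by
  simp [twistedDerivative, hs.apply_one, CharTwo.add_self_eq_zero]

end Solutions

/-! ### The fibres -/

section Fibres

variable {K : Type*} [Field K] [CharP K 2] {σ : K →+* K} {s : K → K} {c b₀ b₁ u v x : K}

/-- In characteristic two the square root of an element of norm one has norm one. -/
theorem mul_map_eq_one_of_sq {a w : K} (ha : a ≠ 0) (hσ : σ (σ a) = a)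
    (hw : w ^ 2 = σ a / a) : w * σ w = 1 := by
  have ha' := (map_ne_zero σ).mpr ha
  have h1 : (w * σ w) ^ 2 = 1 := by
    rw [mul_pow, ← map_pow, hw, map_div₀, hσ, div_mul_div_comm, mul_comm,
      div_self (mul_ne_zero ha ha')]
  have h2 : (w * σ w + 1) ^ 2 = 0 := by
    linear_combination h1 + (w * σ w + 1) * CharTwo.two_eq_zero (R := K)
  exact CharTwo.add_eq_zero.mp (pow_eq_zero_iff two_ne_zero |>.mp h2)

/-- Over a right-hand side whose coordinates are not both fixed by `σ`, the solutions come in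
pairs, exchanged by `IsTwistPair.conj`. -/
theorem IsTwist.ncard_fibre_of_not_fixed (hs : IsTwist σ s) (hσ : ∀ x, σ (σ (σ (σ x))) = x)
    (hc : c * σ (σ c) = 1) (hc1 : c ≠ 1)
    (h₀ : σ (σ b₀) = b₀) (h₁ : σ (σ b₁) = b₁) (hb : ¬ (σ b₀ = b₀ ∧ σ b₁ = b₁)) :
    {x | twistedDerivative s c x = b₀ + b₁ * c}.ncard = 0 ∨
      {x | twistedDerivative s c x = b₀ + b₁ * c}.ncard = 2 := by
  rcases Set.eq_empty_or_nonempty {x | twistedDerivative s c x = b₀ + b₁ * c} with h0 | ⟨x, hx⟩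
  · left
    rw [h0, Set.ncard_empty]
  right
  have hx : twistedDerivative s c x = b₀ + b₁ * c := hx
  obtain ⟨hp, hxe⟩ := hs.isTwistPair hc hc1 (hσ c) h₀ h₁ hx
  have hT : σ (σ (c + σ (σ c))) = c + σ (σ c) := by simp [hσ, add_comm]
  have hTσ := map_trace_ne hc hc1
  have hT0 := trace_ne_zero hc hc1
  have htr : ∀ θ, σ θ = θ → θ ^ 2 + θ ≠ 1 / (c + σ (σ c)) + 1 / σ (c + σ (σ c)) :=
    fun θ hθ => artinSchreier_ne_trace hc hc1 rfl hθ
  have hx0 : x ≠ 0 := by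
    rintro rfl
    rw [hs.twistedDerivative_zero] at hx
    obtain ⟨e0, e1⟩ := coordinates_unique (d₀ := 1) (d₁ := 0) hc hc1 h₀ h₁ (by simp) (by simp)
      (by rw [← hx]; ring)
    exact hb (by simp [e0, e1])
  have hx1 : x ≠ 1 := by
    rintro rfl
    rw [hs.twistedDerivative_one] at hx
    obtain ⟨e0, e1⟩ := coordinates_unique (d₀ := 0) (d₁ := 1) hc hc1 h₀ h₁ (by simp) (by simp)
      (by rw [← hx]; ring)
    exact hb (by simp [e0, e1])
  obtain ⟨u, hu⟩ : ∃ u, u = s (x + 1) := ⟨_, rfl⟩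
  obtain ⟨v, hv⟩ : ∃ v, v = s x := ⟨_, rfl⟩
  rw [← hu, ← hv] at hp hxe
  obtain ⟨w, hw⟩ : ∃ w, w = σ (leadCoeff σ (c + σ (σ c)) (u / v + v / u) b₀ b₁)
    / leadCoeff σ (c + σ (σ c)) (u / v + v / u) b₀ b₁ := ⟨_, rfl⟩
  have ha := hp.leadCoeff_ne_zero hT hTσ hT0 htr h₀ h₁
  have hp' := hp.conj hT hTσ hT0 htr h₀ h₁ hw
  have hu0 := left_ne_zero_of_mul_eq_one hp.norm_u
  have hv0 := left_ne_zero_of_mul_eq_one hp.norm_v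
  have hD := add_mul_ne_zero hc hc1 hp.norm_u hp.norm_v
  have hD' := add_mul_ne_zero hc hc1 hp'.norm_u hp'.norm_v
  -- A vanishing coordinate makes the corresponding quadratic have a double root.
  have hdouble : ∀ z k, z ≠ 0 → k = 0 →
      leadCoeff σ (c + σ (σ c)) (u / v + v / u) b₀ b₁ * z ^ 2 + k * z
        + σ (leadCoeff σ (c + σ (σ c)) (u / v + v / u) b₀ b₁) = 0 → w / z = z := by
    intro z k hz hk h
    rw [hk, zero_mul, add_zero, CharTwo.add_eq_zero] at h
    rw [hw, ← h, mul_div_cancel_left₀ _ ha, sq, mul_div_cancel_right₀ _ hz]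
  obtain ⟨y, hy⟩ : ∃ y, y = (b₀ + b₁ * c + w / u) / (w / u + c * (w / v)) := ⟨_, rfl⟩
  have hye : y * (w / u + c * (w / v)) = b₀ + b₁ * c + w / u := by
    rw [hy, div_mul_cancel₀ _ hD']
  have hy0 : y ≠ 0 := by
    rintro rfl
    rw [zero_mul, eq_comm, CharTwo.add_eq_zero] at hye
    obtain ⟨e0, e1⟩ := coordinates_unique (d₀ := w / u) (d₁ := 0) hc hc1 h₀ h₁
      (inv_fixed_of_norm_one hp'.norm_u) (by simp) (by rw [hye]; ring)
    have h2 := hdouble u _ hu0 (by simp [midCoeff, e1]) hp.eq_u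
    rw [hye, h2, CharTwo.add_self_eq_zero] at hxe
    exact hx0 ((mul_eq_zero.mp hxe).resolve_right hD)
  have hy1 : y ≠ 1 := by
    rintro rfl
    have hye' : b₀ + b₁ * c = 0 + w / v * c := by
      linear_combination -hye
    obtain ⟨e0, e1⟩ := coordinates_unique (d₀ := 0) (d₁ := w / v) hc hc1 h₀ h₁
      (by simp) (inv_fixed_of_norm_one hp'.norm_v) hye'
    have h2 := hdouble v _ hv0 (by simp [midCoeff, e0]) hp.eq_v
    rw [hye', h2] at hxe
    apply hx1
    apply mul_right_cancel₀ hD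
    linear_combination hxe
  obtain ⟨hsu, hsv, hfy⟩ := hs.of_isTwistPair hc hc1 (hσ c) h₀ h₁ hp' hye hy0 hy1
  have hxy : x ≠ y := by
    intro h
    rw [← h, ← hu] at hsu
    rw [← h, ← hv] at hsv
    have huu : u ^ 2 = w := by
      rw [eq_div_iff hu0] at hsu
      rw [← hsu, sq]
    have hvv : v ^ 2 = w := by
      rw [eq_div_iff hv0] at hsv
      rw [← hsv, sq]
    have huv : u = v := by
      have : (u + v) ^ 2 = 0 := by
        rw [CharTwo.add_sq, huu, hvv, CharTwo.add_self_eq_zero]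
      exact CharTwo.add_eq_zero.mp (pow_eq_zero_iff two_ne_zero |>.mp this)
    have he : u / v + v / u = 0 := by rw [huv, CharTwo.add_self_eq_zero]
    have hT0' := (map_ne_zero σ).mpr hT0
    have hk : ∀ z β, z ≠ 0 → z ^ 2 = w →
        leadCoeff σ (c + σ (σ c)) (u / v + v / u) b₀ b₁ * z ^ 2
          + midCoeff σ (c + σ (σ c)) (u / v + v / u) β * z
          + σ (leadCoeff σ (c + σ (σ c)) (u / v + v / u) b₀ b₁) = 0 → σ β = β := by
      intro z β hz hzw h
      rw [hzw, hw, mul_div_cancel₀ _ ha, add_right_comm, CharTwo.add_self_eq_zero, zero_add, he]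
        at h
      have h2 := (mul_eq_zero.mp h).resolve_right hz
      unfold midCoeff at h2
      have h3 : (c + σ (σ c)) * σ (c + σ (σ c)) * (σ β + β) = 0 := by
        linear_combination h2
      exact CharTwo.add_eq_zero.mp
        ((mul_eq_zero.mp h3).resolve_left (mul_ne_zero hT0 hT0'))
    exact hb ⟨hk v b₀ hv0 hvv hp.eq_v, hk u b₁ hu0 huu hp.eq_u⟩
  rw [Set.ncard_eq_two]
  refine ⟨x, y, hxy, Set.ext fun z => ?_⟩
  simp only [Set.mem_ofPred_eq, Set.mem_insert_iff, Set.mem_singleton_iff]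
  constructor
  · intro hz
    obtain ⟨hpz, hze⟩ := hs.isTwistPair hc hc1 (hσ c) h₀ h₁ hz
    have he := hp.ratio_unique hpz hT hTσ hT0 htr h₀ h₁ hb
    rcases hp.eq_or_eq_conj hpz hT hTσ hT0 htr h₀ h₁ he hw with ⟨e1, e2⟩ | ⟨e1, e2⟩
    · left
      rw [e1, e2, ← hxe] at hze
      exact mul_right_cancel₀ hD hze
    · right
      rw [e1, e2, ← hye] at hze
      exact mul_right_cancel₀ hD' hze
  · rintro (rfl | rfl)
    · exact hx
    · exact hfy

/-- At `u = v`, that is `e = 0`, the middle coefficients vanish for coordinates fixed by `σ`. -/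
theorem midCoeff_zero_of_fixed {T β : K} (hβ : σ β = β) : midCoeff σ T 0 β = 0 := by
  rw [midCoeff, hβ]
  linear_combination (β * T * σ T) * CharTwo.two_eq_zero (R := K)

/-- Over a right-hand side whose coordinates are fixed by `σ`, the quadratics force `u = v` and
have a double root. The right-hand sides `1` and `c`, with solutions `0` and `1`, are the only
ones of norm one; for them the quadratic for `e` is void and they are treated separately. -/
theorem IsTwist.ncard_fibre_of_fixed (hs : IsTwist σ s) (hσ : ∀ x, σ (σ (σ (σ x))) = x)
    (hsqrt : ∀ x : K, ∃ y, y ^ 2 = x)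
    (hc : c * σ (σ c) = 1) (hc1 : c ≠ 1) (h₀ : σ b₀ = b₀) (h₁ : σ b₁ = b₁) :
    {x | twistedDerivative s c x = b₀ + b₁ * c}.ncard = 1 := by
  have h₀' : σ (σ b₀) = b₀ := by rw [h₀, h₀]
  have h₁' : σ (σ b₁) = b₁ := by rw [h₁, h₁]
  have hT : σ (σ (c + σ (σ c))) = c + σ (σ c) := by simp [hσ, add_comm]
  have hTσ := map_trace_ne hc hc1
  have hT0 := trace_ne_zero hc hc1
  have htr : ∀ θ, σ θ = θ → θ ^ 2 + θ ≠ 1 / (c + σ (σ c)) + 1 / σ (c + σ (σ c)) :=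
    fun θ hθ => artinSchreier_ne_trace hc hc1 rfl hθ
  have hd : c + σ (σ c) + σ (c + σ (σ c)) ≠ 0 := by
    rw [Ne, CharTwo.add_eq_zero]
    exact hTσ.symm
  rw [Set.ncard_eq_one]
  by_cases hcase : (b₀ = 1 ∧ b₁ = 0) ∨ (b₀ = 0 ∧ b₁ = 1)
  · rcases hcase with ⟨rfl, rfl⟩ | ⟨rfl, rfl⟩
    · refine ⟨0, Set.ext fun x => ?_⟩
      simp only [Set.mem_ofPred_eq, Set.mem_singleton_iff]
      refine ⟨fun hx => ?_, fun hx => by rw [hx, hs.twistedDerivative_zero]; ring⟩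
      obtain ⟨hp, hxe⟩ := hs.isTwistPair hc hc1 (hσ c) h₀' h₁' hx
      have hD := add_mul_ne_zero hc hc1 hp.norm_u hp.norm_v
      have h1 := hp.eq_u
      rw [map_leadCoeff hT h₀' h₁' (map_ratio_add_inv hp.norm_u hp.norm_v)] at h1
      simp only [leadCoeff, midCoeff, normForm, map_zero, zero_mul, mul_zero, one_pow, add_zero,
        zero_pow two_ne_zero, map_one, one_mul] at h1
      have h2 : (c + σ (σ c) + σ (c + σ (σ c))) * (s (x + 1) + 1) ^ 2 = 0 := by
        generalize s (x + 1) = u at *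
        generalize u / s x + s x / u = e at *
        generalize c + σ (σ c) = T at *
        generalize σ T = T' at *
        clear * - h1
        grind
      have h3 := pow_eq_zero_iff two_ne_zero |>.mp ((mul_eq_zero.mp h2).resolve_left hd)
      have h4 : x * (s (x + 1) + c * s x) = 0 := by
        rw [hxe]
        linear_combination h3
      exact (mul_eq_zero.mp h4).resolve_right hD
    · refine ⟨1, Set.ext fun x => ?_⟩
      simp only [Set.mem_ofPred_eq, Set.mem_singleton_iff]
      refine ⟨fun hx => ?_, fun hx => by rw [hx, hs.twistedDerivative_one]; ring⟩
      obtain ⟨hp, hxe⟩ := hs.isTwistPair hc hc1 (hσ c) h₀' h₁' hx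
      have hD := add_mul_ne_zero hc hc1 hp.norm_u hp.norm_v
      have h1 := hp.eq_v
      rw [map_leadCoeff hT h₀' h₁' (map_ratio_add_inv hp.norm_u hp.norm_v)] at h1
      simp only [leadCoeff, midCoeff, normForm, map_zero, zero_mul, mul_zero, one_pow, add_zero,
        zero_add, zero_pow two_ne_zero, map_one, one_mul] at h1
      have h2 : (c + σ (σ c) + σ (c + σ (σ c))) * (s x + 1) ^ 2 = 0 := by
        generalize s x = v at *
        generalize s (x + 1) / v + v / s (x + 1) = e at *
        generalize c + σ (σ c) = T at *
        generalize σ T = T' at *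
        clear * - h1
        grind
      have h3 := pow_eq_zero_iff two_ne_zero |>.mp ((mul_eq_zero.mp h2).resolve_left hd)
      have h4 : s x = 1 := CharTwo.add_eq_zero.mp h3
      apply mul_right_cancel₀ hD
      rw [hxe, h4]
      ring
  -- Away from the two exceptional cases the norm of `b₀ + b₁ * c` is not one.
  have hB : 1 + normForm (c + σ (σ c)) b₀ b₁ ≠ 0 := by
    intro h
    have h' := congrArg σ h
    rw [map_add, map_normForm, h₀, h₁, map_one, map_zero] at h'
    unfold normForm at h h'
    have h2 : (c + σ (σ c) - σ (c + σ (σ c))) * (b₀ * b₁) = 0 := by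
      linear_combination h - h'
    have h3 := (mul_eq_zero.mp h2).resolve_left (sub_ne_zero.mpr hTσ.symm)
    rcases mul_eq_zero.mp h3 with h4 | h4
    · refine hcase (Or.inr ⟨h4, ?_⟩)
      rw [h4] at h
      have : (b₁ + 1) ^ 2 = 0 := by
        linear_combination h + b₁ * CharTwo.two_eq_zero (R := K)
      exact CharTwo.add_eq_zero.mp (pow_eq_zero_iff two_ne_zero |>.mp this)
    · refine hcase (Or.inl ⟨?_, h4⟩)
      rw [h4] at h
      have : (b₀ + 1) ^ 2 = 0 := by
        linear_combination h + b₀ * CharTwo.two_eq_zero (R := K)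
      exact CharTwo.add_eq_zero.mp (pow_eq_zero_iff two_ne_zero |>.mp this)
  have hB' : 1 + normForm (σ (c + σ (σ c))) b₀ b₁ ≠ 0 := by
    have := (map_ne_zero σ).mpr hB
    rwa [map_add, map_normForm, h₀, h₁, map_one] at this
  have ha : leadCoeff σ (c + σ (σ c)) 0 b₀ b₁ ≠ 0 :=
    leadCoeff_ne_zero hT hTσ hT0 htr h₀' h₁' (map_zero σ)
      (midCoeff_zero_of_fixed h₁) (midCoeff_zero_of_fixed h₀)
  have hσa : σ (σ (leadCoeff σ (c + σ (σ c)) 0 b₀ b₁)) = leadCoeff σ (c + σ (σ c)) 0 b₀ b₁ := by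
    simp [leadCoeff, normForm, h₀, h₁, hσ, add_comm]
  obtain ⟨u, hu⟩ := hsqrt (σ (leadCoeff σ (c + σ (σ c)) 0 b₀ b₁)
    / leadCoeff σ (c + σ (σ c)) 0 b₀ b₁)
  have hun := mul_map_eq_one_of_sq ha hσa hu
  have hu0 := left_ne_zero_of_mul_eq_one hun
  have he : u / u + u / u = 0 := CharTwo.add_self_eq_zero _
  have hquad : leadCoeff σ (c + σ (σ c)) 0 b₀ b₁ * u ^ 2
      + σ (leadCoeff σ (c + σ (σ c)) 0 b₀ b₁) = 0 := by
    rw [hu, mul_div_cancel₀ _ ha, CharTwo.add_self_eq_zero]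
  have hp : IsTwistPair σ (c + σ (σ c)) b₀ b₁ u u := by
    refine ⟨hun, hun, ?_, ?_⟩
    · rw [he, midCoeff_zero_of_fixed h₁, zero_mul, add_zero, hquad]
    · rw [he, midCoeff_zero_of_fixed h₀, zero_mul, add_zero, hquad]
  have hD := add_mul_ne_zero hc hc1 hun hun
  obtain ⟨x, hx⟩ : ∃ x, x = (b₀ + b₁ * c + u) / (u + c * u) := ⟨_, rfl⟩
  have hxe : x * (u + c * u) = b₀ + b₁ * c + u := by rw [hx, div_mul_cancel₀ _ hD]
  have hfix1 : σ u = u → u = 1 := by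
    intro h
    rw [h] at hun
    have : (u + 1) ^ 2 = 0 := by
      linear_combination hun + (1 + u) * CharTwo.two_eq_zero (R := K)
    exact CharTwo.add_eq_zero.mp (pow_eq_zero_iff two_ne_zero |>.mp this)
  have hx0 : x ≠ 0 := by
    intro h
    rw [h, zero_mul, eq_comm, CharTwo.add_eq_zero] at hxe
    obtain ⟨e0, e1⟩ := coordinates_unique (d₀ := u) (d₁ := 0) hc hc1 h₀' h₁'
      (inv_fixed_of_norm_one hun) (by simp) (by rw [hxe]; ring)
    exact hcase (Or.inl ⟨by rw [e0]; exact hfix1 (e0 ▸ h₀), e1⟩)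
  have hx1 : x ≠ 1 := by
    intro h
    have hye' : b₀ + b₁ * c = 0 + u * c := by
      rw [h] at hxe
      linear_combination -hxe
    obtain ⟨e0, e1⟩ := coordinates_unique (d₀ := 0) (d₁ := u) hc hc1 h₀' h₁'
      (by simp) (inv_fixed_of_norm_one hun) hye'
    exact hcase (Or.inr ⟨e0, by rw [e1]; exact hfix1 (e1 ▸ h₁)⟩)
  obtain ⟨-, -, hfx⟩ := hs.of_isTwistPair hc hc1 (hσ c) h₀' h₁' hp hxe hx0 hx1
  refine ⟨x, Set.ext fun z => ?_⟩
  simp only [Set.mem_ofPred_eq, Set.mem_singleton_iff]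
  refine ⟨fun hz => ?_, fun hz => by rw [hz, hfx]⟩
  obtain ⟨hpz, hze⟩ := hs.isTwistPair hc hc1 (hσ c) h₀' h₁' hz
  have hq := hpz.quadratic hT hTσ h₀' h₁' rfl
  rw [h₀, h₁, CharTwo.add_self_eq_zero, CharTwo.add_self_eq_zero] at hq
  have hq' : (1 + normForm (c + σ (σ c)) b₀ b₁) * (1 + normForm (σ (c + σ (σ c))) b₀ b₁)
      * (s (z + 1) / s z + s z / s (z + 1)) ^ 2 = 0 := by
    linear_combination hq
  have hez := pow_eq_zero_iff two_ne_zero |>.mp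
    ((mul_eq_zero.mp hq').resolve_left (mul_ne_zero hB hB'))
  rcases hp.eq_or_eq_conj hpz hT hTσ hT0 htr h₀' h₁' (he.trans hez.symm) rfl
    with ⟨e1, e2⟩ | ⟨e1, e2⟩
  · rw [e1, e2, ← hxe] at hze
    exact mul_right_cancel₀ hD hze
  · rw [he, ← hu, sq, mul_div_cancel_right₀ _ hu0] at e1 e2
    rw [e1, e2, ← hxe] at hze
    exact mul_right_cancel₀ hD hze

end Fibres

/-! ### Counting over the finite field -/

section FiniteFields

/-- In a finite field of order `q ^ 4`, the equation `x ^ q = x` has `q` solutions. -/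
theorem ncard_pow_eq_self {K : Type*} [Field K] [Finite K] {q : ℕ} (hq : 2 ≤ q)
    (hK : Nat.card K = q ^ 4) : {x : K | x ^ q = x}.ncard = q := by
  classical
  obtain ⟨g, hg⟩ := IsCyclic.exists_ofOrder_eq_natCard (α := Kˣ)
  have hcard : Nat.card Kˣ = (q - 1) * (q ^ 3 + q ^ 2 + q + 1) := by
    rw [Nat.card_units, hK]
    obtain ⟨m, rfl⟩ : ∃ m, q = m + 1 := ⟨q - 1, by omega⟩
    rw [Nat.add_sub_cancel, Nat.sub_eq_iff_eq_add (Nat.one_le_pow _ _ (by omega))]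
    ring
  have hprim : IsPrimitiveRoot (g : K) (Nat.card Kˣ) := by
    rw [← hg, ← orderOf_units]
    exact IsPrimitiveRoot.orderOf _
  have hζ : IsPrimitiveRoot ((g : K) ^ (q ^ 3 + q ^ 2 + q + 1)) (q - 1) :=
    hprim.pow Nat.card_pos (by rw [hcard, mul_comm])
  have hset : {x : K | x ^ q = x}
      = insert 0 ((Polynomial.nthRootsFinset (q - 1) (1 : K) : Finset K) : Set K) := by
    ext x
    have hq1 : q - 1 + 1 = q := by omega
    rw [Set.mem_insert_iff, Finset.mem_coe, Polynomial.mem_nthRootsFinset (by omega),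
      Set.mem_ofPred_eq, ← hq1, pow_succ]
    constructor
    · intro h
      by_cases hx : x = 0
      · exact Or.inl hx
      · exact Or.inr (mul_right_cancel₀ hx (by simpa using h))
    · rintro (rfl | h)
      · simp
      · rw [Nat.add_sub_cancel] at h
        rw [h, one_mul]
  rw [hset, Set.ncard_insert_of_notMem, Set.ncard_coe_finset, hζ.card_nthRootsFinset]
  · omega
  · rw [Finset.mem_coe, Polynomial.mem_nthRootsFinset (by omega), zero_pow (by omega)]
    exact zero_ne_one

/-- If a self-map of a finite type has fibres of size at most two, then as many points have two
preimages as have none. -/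
theorem ncard_fibre_zero_eq_two {α : Type*} [Finite α] (f : α → α)
    (hf : ∀ b, {x | f x = b}.ncard = 0 ∨ {x | f x = b}.ncard = 1 ∨ {x | f x = b}.ncard = 2) :
    {b | {x | f x = b}.ncard = 0}.ncard = {b | {x | f x = b}.ncard = 2}.ncard ∧
      {b | {x | f x = b}.ncard = 1}.ncard + 2 * {b | {x | f x = b}.ncard = 2}.ncard
        = Nat.card α := by
  classical
  have := Fintype.ofFinite α
  have hsum : Fintype.card α = ∑ b, {x | f x = b}.ncard := by
    rw [← Finset.card_univ, Finset.card_eq_sum_card_fiberwise (f := f) (t := Finset.univ)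
      (by simp)]
    refine Finset.sum_congr rfl fun b _ => ?_
    rw [← Set.ncard_coe_finset]
    simp
  have hcard : ∀ i, {b | {x | f x = b}.ncard = i}.ncard
      = ∑ b, if {x | f x = b}.ncard = i then 1 else 0 := by
    intro i
    rw [Finset.sum_boole, Nat.cast_id, ← Set.ncard_coe_finset]
    simp
  have h1 : Fintype.card α = {b | {x | f x = b}.ncard = 1}.ncard
      + 2 * {b | {x | f x = b}.ncard = 2}.ncard := by
    rw [hsum, hcard, hcard, Finset.mul_sum, ← Finset.sum_add_distrib]
    refine Finset.sum_congr rfl fun b _ => ?_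
    rcases hf b with h | h | h <;> simp [h]
  have h2 : Fintype.card α = {b | {x | f x = b}.ncard = 0}.ncard
      + {b | {x | f x = b}.ncard = 1}.ncard + {b | {x | f x = b}.ncard = 2}.ncard := by
    rw [hcard, hcard, hcard, ← Finset.sum_add_distrib, ← Finset.sum_add_distrib,
      ← Finset.card_univ, Finset.card_eq_sum_ones]
    refine Finset.sum_congr rfl fun b _ => ?_
    rcases hf b with h | h | h <;> simp [h]
  rw [Nat.card_eq_fintype_card]
  omega

variable {K : Type*} [Field K]

theorem exists_sq_eq [Finite K] [CharP K 2] (x : K) : ∃ y, y ^ 2 = x :=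
  Finite.surjective_of_injective (CharTwo.sq_injective (R := K)) x

theorem pow_natCard [Finite K] (x : K) : x ^ Nat.card K = x := by
  have := Fintype.ofFinite K
  rw [Nat.card_eq_fintype_card, FiniteField.pow_card]

theorem charP_two_of_natCard [Finite K] {n : ℕ} (hK : Nat.card K = 2 ^ n) : CharP K 2 := by
  have := Fintype.ofFinite K
  have h := FiniteField.cast_card_eq_zero K
  rw [← Nat.card_eq_fintype_card, hK, Nat.cast_pow] at h
  exact CharTwo.of_one_ne_zero_of_two_eq_zero one_ne_zero
    (by simpa using eq_zero_of_pow_eq_zero h)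

/-- The power map with exponent `(q - 1) * (q ^ 2 + 1) + 2` is the square of a twisted identity:
the twist is the square root of the `(q - 1)`-st power of the relative norm. -/
theorem exists_isTwist [Finite K] [CharP K 2] {q : ℕ} (hq : 2 ≤ q) (hK : Nat.card K = q ^ 4)
    (σ : K →+* K) (hσ : ∀ x, σ x = x ^ q) :
    ∃ s : K → K, IsTwist σ s ∧ ∀ x, x ^ ((q - 1) * (q ^ 2 + 1) + 2) = (s x * x) ^ 2 := by
  have hN : ∀ x : K, x * σ (σ x) = x ^ (q ^ 2 + 1) := by
    intro x
    rw [hσ, hσ, ← pow_mul]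
    ring
  have hex : ∀ x : K, ∃ t : K, (x ≠ 0 → t ^ 2 = (x * σ (σ x)) ^ (q - 1)) ∧ (x = 0 → t = 1) := by
    intro x
    by_cases hx : x = 0
    · exact ⟨1, fun h => (h hx).elim, fun _ => rfl⟩
    · obtain ⟨t, ht⟩ := exists_sq_eq ((x * σ (σ x)) ^ (q - 1))
      exact ⟨t, fun _ => ht, fun h => (hx h).elim⟩
  choose s hs hs0 using hex
  have hpow : ∀ z : K, z ^ (q - 1) * z = z ^ q := by
    intro z
    rw [← pow_succ]
    congr 1
    omega
  have hnorm : ∀ x, s x * σ (s x) = 1 := by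
    intro x
    by_cases hx : x = 0
    · rw [hs0 x hx, map_one, one_mul]
    · apply CharTwo.sq_injective (R := K)
      have hx4 : x ^ (q ^ 4 - 1) = 1 := by
        apply mul_right_cancel₀ hx
        rw [← pow_succ, Nat.sub_add_cancel (Nat.one_le_pow _ _ (by omega)), ← hK, pow_natCard,
          one_mul]
      have hexp : (q ^ 2 + 1) * ((q - 1) * (q + 1)) = q ^ 4 - 1 := by
        obtain ⟨m, rfl⟩ : ∃ m, q = m + 1 := ⟨q - 1, by omega⟩
        rw [Nat.add_sub_cancel, eq_comm,
          Nat.sub_eq_iff_eq_add (Nat.one_le_pow _ _ (by omega))]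
        ring
      change (s x * σ (s x)) ^ 2 = 1 ^ 2
      rw [hσ, ← pow_succ', ← pow_mul, mul_comm, pow_mul, hs x hx, hN, ← pow_mul, ← pow_mul,
        hexp, hx4, one_pow]
  refine ⟨s, ⟨hnorm, ?_, ?_⟩, ?_⟩
  · intro x
    by_cases hx : x = 0
    · rw [hx, zero_mul, mul_zero, map_zero]
    · rw [map_mul, hσ (x * _), ← hpow, ← hs x hx]
      linear_combination s x * (x * σ (σ x)) * hnorm x
  · intro x v hx hv h
    have hx' : x * σ (σ x) ≠ 0 :=
      mul_ne_zero hx ((map_ne_zero σ).mpr ((map_ne_zero σ).mpr hx))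
    rw [map_mul, hσ (x * _), ← hpow, ← hs x hx] at h
    apply CharTwo.sq_injective (R := K)
    apply mul_right_cancel₀ hx'
    change s x ^ 2 * _ = v ^ 2 * _
    linear_combination v * h - s x ^ 2 * (x * σ (σ x)) * hv
  · intro x
    by_cases hx : x = 0
    · rw [hx, mul_zero, zero_pow two_ne_zero, zero_pow (by omega)]
    · rw [mul_pow, hs x hx, hN, ← pow_mul, pow_add, mul_comm (q - 1)]

/-- The number of right-hand sides of each kind for the equation in squared form. -/
theorem cOmegaSq_eq [Finite K] {n q : ℕ} (hn : 1 ≤ n) (hq : q = 2 ^ n)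
    (hK : Nat.card K = q ^ 4) {c : K} (hc : c ^ (q ^ 2 + 1) = 1) (hc1 : c ≠ 1) :
    cOmegaSq K q c 0 = cOmegaSq K q c 2 ∧ cOmegaSq K q c 1 = q ^ 2 ∧
      cOmegaSq K q c 1 + 2 * cOmegaSq K q c 2 = q ^ 4 := by
  have : CharP K 2 := charP_two_of_natCard (n := n * 4) (by rw [hK, hq, pow_mul])
  have hq2 : 2 ≤ q := by
    rw [hq]
    calc 2 = 2 ^ 1 := (pow_one 2).symm
      _ ≤ 2 ^ n := Nat.pow_le_pow_right (by norm_num) hn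
  obtain ⟨σ, hσ⟩ : ∃ σ : K →+* K, ∀ x, σ x = x ^ q :=
    ⟨iterateFrobenius K 2 n, fun x => by rw [iterateFrobenius_def, hq]⟩
  have hσ4 : ∀ x, σ (σ (σ (σ x))) = x := by
    intro x
    rw [hσ, hσ, hσ, hσ, ← pow_mul, ← pow_mul, ← pow_mul]
    calc x ^ (q * (q * (q * q))) = x ^ Nat.card K := by rw [hK]; ring
      _ = x := pow_natCard x
  have hcσ : c * σ (σ c) = 1 := by
    rw [hσ, hσ, ← pow_mul, ← hc]
    ring
  obtain ⟨s, hs, hsx⟩ := exists_isTwist hq2 hK σ hσ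
  have hset : ∀ b : K, {x : K | (x + 1) ^ ((q - 1) * (q ^ 2 + 1) + 2)
      + c ^ 2 * x ^ ((q - 1) * (q ^ 2 + 1) + 2) = b ^ 2}
      = {x | twistedDerivative s c x = b} := by
    intro b
    ext x
    rw [Set.mem_ofPred_eq, Set.mem_ofPred_eq, hsx, hsx, ← mul_pow, ← CharTwo.add_sq]
    exact (CharTwo.sq_injective (R := K)).eq_iff
  have hom : ∀ i, cOmegaSq K q c i = {b | {x | twistedDerivative s c x = b}.ncard = i}.ncard := by
    intro i
    unfold cOmegaSq
    simp only [hset]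
  have hfib1 : ∀ b₀ b₁, σ b₀ = b₀ → σ b₁ = b₁ →
      {x | twistedDerivative s c x = b₀ + b₁ * c}.ncard = 1 := fun b₀ b₁ h₀ h₁ =>
    hs.ncard_fibre_of_fixed hσ4 exists_sq_eq hcσ hc1 h₀ h₁
  have hfib : ∀ b, {x | twistedDerivative s c x = b}.ncard = 0 ∨
      {x | twistedDerivative s c x = b}.ncard = 1 ∨
      {x | twistedDerivative s c x = b}.ncard = 2 := by
    intro b
    obtain ⟨b₀, b₁, h₀, h₁, rfl⟩ := exists_coordinates hσ4 hcσ hc1 b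
    by_cases hb : σ b₀ = b₀ ∧ σ b₁ = b₁
    · exact Or.inr (Or.inl (hfib1 _ _ hb.1 hb.2))
    · rcases hs.ncard_fibre_of_not_fixed hσ4 hcσ hc1 h₀ h₁ hb with h | h
      · exact Or.inl h
      · exact Or.inr (Or.inr h)
  have hone : {b | {x | twistedDerivative s c x = b}.ncard = 1}
      = (fun p : K × K => p.1 + p.2 * c) '' ({x | σ x = x} ×ˢ {x | σ x = x}) := by
    ext b
    constructor
    · intro hb
      have hb : {x | twistedDerivative s c x = b}.ncard = 1 := hb
      obtain ⟨b₀, b₁, h₀, h₁, rfl⟩ := exists_coordinates hσ4 hcσ hc1 b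
      by_cases hf : σ b₀ = b₀ ∧ σ b₁ = b₁
      · exact ⟨(b₀, b₁), hf, rfl⟩
      · rcases hs.ncard_fibre_of_not_fixed hσ4 hcσ hc1 h₀ h₁ hf with h | h <;> omega
    · rintro ⟨⟨b₀, b₁⟩, ⟨h₀, h₁⟩, rfl⟩
      exact hfib1 b₀ b₁ h₀ h₁
  have hcount := ncard_fibre_zero_eq_two (twistedDerivative s c) hfib
  have hfix : {x : K | σ x = x}.ncard = q := by
    simp only [hσ]
    exact ncard_pow_eq_self hq2 hK
  have hone' : {b | {x | twistedDerivative s c x = b}.ncard = 1}.ncard = q ^ 2 := by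
    rw [hone, Set.InjOn.ncard_image, Set.ncard_prod, hfix, sq]
    rintro ⟨b₀, b₁⟩ ⟨h₀, h₁⟩ ⟨d₀, d₁⟩ ⟨k₀, k₁⟩ h
    have h₀ : σ b₀ = b₀ := h₀
    have h₁ : σ b₁ = b₁ := h₁
    have k₀ : σ d₀ = d₀ := k₀
    have k₁ : σ d₁ = d₁ := k₁
    obtain ⟨e0, e1⟩ := coordinates_unique hcσ hc1 (by rw [h₀, h₀]) (by rw [h₁, h₁])
      (by rw [k₀, k₀]) (by rw [k₁, k₁]) h
    exact Prod.ext e0 e1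
  rw [hom, hom, hom, ← hK]
  exact ⟨hcount.1, hone', hcount.2⟩

/-- Raising the `c`-differential equation to the power `q ^ 2` turns it into the equation in
squared form with a square root of `c⁻¹` in place of `c`. -/
theorem exists_cOmega_eq_cOmegaSq [Finite K] {n q : ℕ} (hn : 1 ≤ n) (hq : q = 2 ^ n)
    (hK : Nat.card K = q ^ 4) {c : K} (hc : c ^ (q ^ 2 + 1) = 1) (hc1 : c ≠ 1) :
    ∃ d : K, d ^ (q ^ 2 + 1) = 1 ∧ d ≠ 1 ∧
      ∀ i, cOmega (fun x : K => x ^ (q ^ 3 + q ^ 2 + q - 1)) c i = cOmegaSq K q d i := by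
  have : CharP K 2 := charP_two_of_natCard (n := n * 4) (by rw [hK, hq, pow_mul])
  have hq2 : 2 ≤ q := by
    rw [hq]
    calc 2 = 2 ^ 1 := (pow_one 2).symm
      _ ≤ 2 ^ n := Nat.pow_le_pow_right (by norm_num) hn
  obtain ⟨τ, hτ⟩ : ∃ τ : K →+* K, ∀ x, τ x = x ^ q ^ 2 :=
    ⟨iterateFrobenius K 2 (n * 2), fun x => by rw [iterateFrobenius_def, hq, pow_mul]⟩
  have hcinv : c ^ q ^ 2 = c⁻¹ := eq_inv_of_mul_eq_one_left (by rw [← pow_succ, hc])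
  obtain ⟨d, hd⟩ := exists_sq_eq c⁻¹
  have hpow : ∀ x : K, (x ^ (q ^ 3 + q ^ 2 + q - 1)) ^ q ^ 2
      = x ^ ((q - 1) * (q ^ 2 + 1) + 2) := by
    intro x
    by_cases hx : x = 0
    · rw [hx, zero_pow (by omega), zero_pow (by positivity), zero_pow (by omega)]
    have hexp : (q ^ 3 + q ^ 2 + q - 1) * q ^ 2 + (q + 1)
        = ((q - 1) * (q ^ 2 + 1) + 2) + q ^ 4 * (q + 1) := by
      obtain ⟨m, rfl⟩ : ∃ m, q = m + 1 := ⟨q - 1, by omega⟩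
      have h1 : (m + 1) ^ 3 + (m + 1) ^ 2 + (m + 1) - 1 = (m + 1) ^ 3 + (m + 1) ^ 2 + m := by omega
      rw [h1, Nat.add_sub_cancel]
      ring
    apply mul_right_cancel₀ (pow_ne_zero (q + 1) hx)
    rw [← pow_mul, ← pow_add, hexp, pow_add, pow_mul x (q ^ 4), ← hK, pow_natCard]
  refine ⟨d, ?_, ?_, ?_⟩
  · apply CharTwo.sq_injective (R := K)
    change (d ^ (q ^ 2 + 1)) ^ 2 = 1 ^ 2
    rw [← pow_mul, mul_comm, pow_mul, hd, inv_pow, hc, inv_one, one_pow]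
  · rintro rfl
    apply hc1
    rw [one_pow, eq_comm, inv_eq_one] at hd
    exact hd
  · -- The right-hand sides correspond under `b ↦ r b` with `(r b) ^ 2 = b ^ (q ^ 2)`.
    intro i
    choose r hr using fun b : K => exists_sq_eq (τ b)
    have hrinj : Function.Injective r := by
      intro a b hab
      apply τ.injective
      rw [← hr, ← hr, hab]
    have hset : ∀ b, {x : K | cDerivative (fun x : K => x ^ (q ^ 3 + q ^ 2 + q - 1)) c 1 x = b}
        = {x : K | (x + 1) ^ ((q - 1) * (q ^ 2 + 1) + 2)
          + d ^ 2 * x ^ ((q - 1) * (q ^ 2 + 1) + 2) = r b ^ 2} := by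
      intro b
      ext x
      rw [Set.mem_ofPred_eq, Set.mem_ofPred_eq, hr, hd, ← hpow, ← hpow, ← hcinv, ← hτ, ← hτ,
        ← hτ, ← map_mul, ← map_add, τ.injective.eq_iff, cDerivative, CharTwo.sub_eq_add]
    unfold cOmega cOmegaSq cDelta
    simp only [hset]
    have hrsurj : Function.Surjective r := Finite.surjective_of_injective hrinj
    rw [← Set.ncard_image_of_injective _ hrinj]
    congr 1
    ext b
    constructor
    · rintro ⟨a, ha, rfl⟩
      exact ha
    · intro hb
      obtain ⟨a, rfl⟩ := hrsurj b
      exact ⟨a, hb, rfl⟩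

end FiniteFields

theorem theorem2 (n q : ℕ) (hn : 1 ≤ n) (hq : q = 2 ^ n)
    (K : Type*) [Field K] [Finite K] (hK : Nat.card K = q ^ 4)
    (c : K) (hc : c ^ (q ^ 2 + 1) = 1) (hc1 : c ≠ 1) :
    ((cOmega (fun x : K => x ^ (q ^ 3 + q ^ 2 + q - 1)) c 0 : ℚ) = ((q : ℚ) ^ 4 - (q : ℚ) ^ 2) / 2 ∧
      (cOmega (fun x : K => x ^ (q ^ 3 + q ^ 2 + q - 1)) c 2 : ℚ) = ((q : ℚ) ^ 4 - (q : ℚ) ^ 2) / 2 ∧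
      cOmega (fun x : K => x ^ (q ^ 3 + q ^ 2 + q - 1)) c 1 = q ^ 2) ∧
    ((cOmegaSq K q c 0 : ℚ) = ((q : ℚ) ^ 4 - (q : ℚ) ^ 2) / 2 ∧
      (cOmegaSq K q c 2 : ℚ) = ((q : ℚ) ^ 4 - (q : ℚ) ^ 2) / 2 ∧
      cOmegaSq K q c 1 = q ^ 2) := by
  have key : ∀ d : K, d ^ (q ^ 2 + 1) = 1 → d ≠ 1 →
      (cOmegaSq K q d 0 : ℚ) = ((q : ℚ) ^ 4 - (q : ℚ) ^ 2) / 2 ∧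
      (cOmegaSq K q d 2 : ℚ) = ((q : ℚ) ^ 4 - (q : ℚ) ^ 2) / 2 ∧
      cOmegaSq K q d 1 = q ^ 2 := by
    intro d hd hd1
    obtain ⟨h02, h1, hsum⟩ := cOmegaSq_eq hn hq hK hd hd1
    rw [h1] at hsum
    have hsum' : (q : ℚ) ^ 2 + 2 * (cOmegaSq K q d 2 : ℚ) = (q : ℚ) ^ 4 := by exact_mod_cast hsum
    have h2 : (cOmegaSq K q d 2 : ℚ) = ((q : ℚ) ^ 4 - (q : ℚ) ^ 2) / 2 := by linarith
    exact ⟨by rw [h02, h2], h2, h1⟩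
  refine ⟨?_, key c hc hc1⟩
  obtain ⟨d, hd, hd1, hom⟩ := exists_cOmega_eq_cOmegaSq hn hq hK hc hc1
  rw [hom, hom, hom]
  exact key d hd hd1
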